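/- Let $n\ge 2$ and let $\mathcal R$ be a cyclic system of rank $n$: for each context $i\in\{1,\dots,n\}$ a pair (bunch) of jointly distributed $0/1$-valued random variables $R_i^i,R_{i\oplus1}^i$ (indices are cyclic modulo $n$; different bunches are stochastically unrelated). Put $p_j^i=\Pr[R_j^i=1]$ for $j\in\{i,i\oplus1\}$, $p^*_{i,i\oplus1}=\Pr[R_i^i=R_{i\oplus1}^i=1]$ and $p^{*\,i,i\ominus1}=\min(p_i^i,p_i^{i\ominus1})$, and let $\mathbf p_b^*=(p^*_{i,i\oplus1})_i$, $\mathbf p_c^*=(p^{*\,i,i\ominus1})_i$. A coupling of $\mathcal R$ is a family of jointly distributed $0/1$-variables $S_j^i$ ($j=i,i\oplus1$; $i=1,\dots,n$) with $\Pr[S_j^i=1]=p_j^i$ and $\Pr[S_i^i=S_{i\oplus1}^i=1]=p^*_{i,i\oplus1}$. The system is noncontextual if it has a coupling with $\Pr[S_i^i=S_i^{i\ominus1}=1]=p^{*\,i,i\ominus1}$ for all $i$, and contextual otherwise. Let $\mathbb P\subset\mathbb R^{2n}$ be the polytope of all vectors $(\mathbf p_b,\mathbf p_c)=\big((\Pr[S_i^i=S_{i\oplus1}^i=1])_i,(\Pr[S_i^i=S_i^{i\ominus1}=1])_i\big)$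 arising from jointly distributed $0/1$-variables $S_j^i$ with $\Pr[S_j^i=1]=p_j^i$ for all $i$ and $j\in\{i,i\oplus 1\}$; let $\mathbb P_c=\{\mathbf p_c:(\mathbf p_b^*,\mathbf p_c)\in\mathbb P\}$ and $\mathbb P_b=\{\mathbf p_b:(\mathbf p_b,\mathbf p_c^*)\in\mathbb P\}$. Let $\phi$ be the relabeling map from $0/1$ to $\pm1$, $$e_{i,i\oplus1}=4p_{i,i\oplus1}-2p_i^i-2p_{i\oplus1}^i+1,\qquad e^{i,i\ominus1}=4p^{i,i\ominus1}-2p_i^i-2p_i^{i\ominus1}+1,$$ and put $\mathbb E=\phi(\mathbb P)$, $(\mathbf e_b^*,\mathbf e_c^*)=\phi(\mathbf p_b^*,\mathbf p_c^*)$, $e_j^i=2p_j^i-1$, $\delta=\sum_{i=1}^n|e_i^i-e_i^{i\ominus1}|$. Write $L_1(x,A)$ for the $L_1$-distance from a point $x$ to a set $A$, and $$\mathrm{CNT}_0=L_1\big((\mathbf p_b^*,\mathbf p_c^*),\mathbb P\big),\quad \mathrm{CNT}_1=L_1(\mathbf p_c^*,\mathbb P_c),\quad \mathrm{CNT}_2=L_1(\mathbf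 p_b^*,\mathbb P_b).$$ For $x\in\mathbb R^m$ let $s_1(x)=\max\{\sum_k\lambda_kx_k:\lambda_k=\pm1,\ \prod_k\lambda_k=-1\}$. **Theorem.** Suppose $\mathcal R$ is contextual. Then: 1. The $L_1$-distance from $(\mathbf e_b^*,\mathbf e_c^*)$ to $\mathbb E$ is attained and equals $s_1(\mathbf e_b^*,\mathbf e_c^*)-(2n-2)$. 2. It is a single-coordinate distance along every coordinate: for each of the $2n$ coordinates $k$, the smallest $L_1$-distance from $(\mathbf e_b^*,\mathbf e_c^*)$ to a point of $\mathbb E$ that differs from it at most in coordinate $k$ exists and also equals $s_1(\mathbf e_b^*,\mathbf e_c^*)-(2n-2)$. 3. $\mathrm{CNT}_0=\tfrac14L_1\big((\mathbf e_b^*,\mathbf e_c^*),\mathbb E\big)=\tfrac14\big(s_1(\mathbf e_b^*,\mathbf e_c^*)-(2n-2)\big)$. 4. $\mathbb P_b$ and $\mathbb P_c$ are non-empty, and $\mathrm{CNT}_0=\mathrm{CNT}_1=\mathrm{CNT}_2$. 5. $s_1(\mathbf e_b^*,\mathbf e_c^*)=s_1(\mathbf e_b^*)+n-\delta$. -/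

import Mathlib

open scoped Matrix

noncomputable section

/-- The odd-sign maximum `s₁(x) = max { ∑ λᵢ xᵢ : λᵢ = ±1, ∏ λᵢ = -1 }`. -/
def sOne {ι : Type} [Fintype ι] (x : ι → ℝ) : ℝ :=
  sSup ((fun l : ι → ℤˣ => ∑ i, ((l i : ℤ) : ℝ) * x i) '' {l | ∏ i, l i = -1})

/-- The set of all `L₁`-distances `‖x - y‖₁` from the point `x` to the points `y ∈ A`. -/
def lOneDistances {ι : Type} [Fintype ι] (x : ι → ℝ) (A : Set (ι → ℝ)) : Set ℝ :=
  (fun y => ∑ i, |x i - y i|) '' A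

/-- The `L₁`-distance from the point `x` to the set `A`. -/
def lOneDist {ι : Type} [Fintype ι] (x : ι → ℝ) (A : Set (ι → ℝ)) : ℝ :=
  sInf (lOneDistances x A)

/-- The points of `A` that agree with `x` in every coordinate other than `k`. -/
def alongCoord {ι : Type} (k : ι) (x : ι → ℝ) (A : Set (ι → ℝ)) : Set (ι → ℝ) :=
  {y | y ∈ A ∧ ∀ j, j ≠ k → y j = x j}

/-- A cyclic system of rank `n`: in every context `i` a joint distribution of the bunch
`(R_i^i, R_{i⊕1}^i)` of two dichotomous random variables (`true` stands for the value `1` and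
`false` for the value `0`). Distinct bunches are stochastically unrelated. -/
structure CyclicSystem (n : ℕ) where
  /-- `bunch i (a, b)` is the probability of `R_i^i = a` and `R_{i⊕1}^i = b`. -/
  bunch : Fin n → Bool × Bool → ℝ
  bunch_mem : ∀ i, bunch i ∈ stdSimplex ℝ (Bool × Bool)

/-- Labels of the `2n` random variables of a cyclic system:
`(i, false)` stands for `R_i^i`, and `(i, true)` for `R_{i⊕1}^i`. -/
abbrev CyclicVar (n : ℕ) : Type := Fin n × Bool

/-- Joint values of all `2n` random variables. -/
abbrev CyclicOutcome (n : ℕ) : Type := CyclicVar n → Bool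

/-- The two variables in the context `i`: `R_i^i` and `R_{i⊕1}^i`. -/
def bunchVars {n : ℕ} (i : Fin n) : Finset (CyclicVar n) := {(i, false), (i, true)}

/-- The two variables measuring the content `i`: `R_i^i` and `R_i^{i⊖1}`
(subtraction in `Fin n` is modulo `n`). -/
def connVars {n : ℕ} [NeZero n] (i : Fin n) : Finset (CyclicVar n) := {(i, false), (i - 1, true)}

/-- For a joint distribution `g` of all the variables: the probability that all variables in `A`
equal `1`, i.e. the expectation of the product of these `0/1`-variables. -/
def prodExpect {n : ℕ} (g : CyclicOutcome n → ℝ) (A : Finset (CyclicVar n)) : ℝ :=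
  ∑ r with (∀ v ∈ A, r v = true), g r

/-- The cell of the incidence matrix in the row of the product of the variables in `A` and
in the column of the outcome `r`. -/
def incidence {n : ℕ} (A : Finset (CyclicVar n)) (r : CyclicOutcome n) : ℝ :=
  if ∀ v ∈ A, r v = true then 1 else 0

/-- The block `M_l`; the row `none` is the row of the empty product `⟨⟩ = 1`. -/
def matL (n : ℕ) : Matrix (Option (CyclicVar n)) (CyclicOutcome n) ℝ :=
  fun v r => incidence v.toFinset r

/-- The block `M_b`. -/
def matB (n : ℕ) : Matrix (Fin n) (CyclicOutcome n) ℝ :=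
  fun i r => incidence (bunchVars i) r

/-- The block `M_c`. -/
def matC (n : ℕ) [NeZero n] : Matrix (Fin n) (CyclicOutcome n) ℝ :=
  fun i r => incidence (connVars i) r

namespace CyclicSystem

variable {n : ℕ}

/-- `p_i^i` (at `(i, false)`) and `p_{i⊕1}^i` (at `(i, true)`): the probability that the variable
equals `1`. -/
def marg (R : CyclicSystem n) : CyclicVar n → ℝ
  | (i, false) => R.bunch i (true, true) + R.bunch i (true, false)
  | (i, true) => R.bunch i (true, true) + R.bunch i (false, true)

/-- The vector `p_l*` of single-variable expectations, preceded by `⟨⟩ = 1`. -/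
def pl (R : CyclicSystem n) : Option (CyclicVar n) → ℝ
  | none => 1
  | some v => R.marg v

/-- The vector `p_b*` of bunch product expectations. -/
def pb (R : CyclicSystem n) (i : Fin n) : ℝ := R.bunch i (true, true)

/-- The vector `p_c*` of connection product expectations in the maximal couplings of the
connections. -/
def pc [NeZero n] (R : CyclicSystem n) (i : Fin n) : ℝ :=
  min (R.marg (i, false)) (R.marg (i - 1, true))

/-- `g` is the joint distribution of an overall coupling of the system. -/
def IsCoupling (R : CyclicSystem n) (g : CyclicOutcome n → ℝ) : Prop :=
  g ∈ stdSimplex ℝ (CyclicOutcome n) ∧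
    (∀ v, prodExpect g {v} = R.marg v) ∧ ∀ i, prodExpect g (bunchVars i) = R.pb i

/-- The system has a coupling which induces the maximal connection product expectations. -/
def Noncontextual [NeZero n] (R : CyclicSystem n) : Prop :=
  ∃ g, R.IsCoupling g ∧ ∀ i, prodExpect g (connVars i) = R.pc i

def Contextual [NeZero n] (R : CyclicSystem n) : Prop := ¬ R.Noncontextual

/-- The polytope `ℙ` of all vectors `(p_b, p_c)` compatible with `p_l*`
(`Sum.inl` are the bunch coordinates, `Sum.inr` the connection coordinates). -/
def polyP [NeZero n] (R : CyclicSystem n) : Set (Fin n ⊕ Fin n → ℝ) :=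
  {p | ∃ h : CyclicOutcome n → ℝ, (∀ r, 0 ≤ h r) ∧ matL n *ᵥ h = R.pl ∧
    (matB n *ᵥ h = fun i => p (Sum.inl i)) ∧ matC n *ᵥ h = fun i => p (Sum.inr i)}

/-- The feasibility polytope `ℙ_c`. -/
def polyPc [NeZero n] (R : CyclicSystem n) : Set (Fin n → ℝ) :=
  {p | ∃ h : CyclicOutcome n → ℝ, (∀ r, 0 ≤ h r) ∧ matL n *ᵥ h = R.pl ∧
    matB n *ᵥ h = R.pb ∧ matC n *ᵥ h = p}

/-- The noncontextuality polytope `ℙ_b`. -/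
def polyPb [NeZero n] (R : CyclicSystem n) : Set (Fin n → ℝ) :=
  {p | ∃ h : CyclicOutcome n → ℝ, (∀ r, 0 ≤ h r) ∧ matL n *ᵥ h = R.pl ∧
    matB n *ᵥ h = p ∧ matC n *ᵥ h = R.pc}

/-- `CNT₀`: the `L₁`-distance from `(p_b*, p_c*)` to `ℙ`. -/
def CNT0 [NeZero n] (R : CyclicSystem n) : ℝ := lOneDist (Sum.elim R.pb R.pc) R.polyP

/-- `CNT₁`: the `L₁`-distance from `p_c*` to `ℙ_c`. -/
def CNT1 [NeZero n] (R : CyclicSystem n) : ℝ := lOneDist R.pc R.polyPc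

/-- `CNT₂`: the `L₁`-distance from `p_b*` to `ℙ_b`. -/
def CNT2 [NeZero n] (R : CyclicSystem n) : ℝ := lOneDist R.pb R.polyPb

/-- The expectation `e_j^i = 2 p_j^i - 1` of the relabeled `±1`-variable `2 R_j^i - 1`. -/
def el (R : CyclicSystem n) (v : CyclicVar n) : ℝ := 2 * R.marg v - 1

/-- The transformation `φ` of bunch product expectations under the relabeling. -/
def phiB (R : CyclicSystem n) (p : Fin n → ℝ) (i : Fin n) : ℝ :=
  4 * p i - 2 * R.marg (i, false) - 2 * R.marg (i, true) + 1

/-- The transformation `φ` of connection product expectations under the relabeling. -/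
def phiC [NeZero n] (R : CyclicSystem n) (p : Fin n → ℝ) (i : Fin n) : ℝ :=
  4 * p i - 2 * R.marg (i, false) - 2 * R.marg (i - 1, true) + 1

/-- The transformation `φ` on vectors `(p_b, p_c)`. -/
def phi [NeZero n] (R : CyclicSystem n) (p : Fin n ⊕ Fin n → ℝ) : Fin n ⊕ Fin n → ℝ :=
  Sum.elim (R.phiB fun i => p (Sum.inl i)) (R.phiC fun i => p (Sum.inr i))

/-- The polytope `𝔼 = φ(ℙ)` of all possible couplings. -/
def polyE [NeZero n] (R : CyclicSystem n) : Set (Fin n ⊕ Fin n → ℝ) := R.phi '' R.polyP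

/-- `e_b*`. -/
def eb (R : CyclicSystem n) : Fin n → ℝ := R.phiB R.pb

/-- `e_c*`. -/
def ec [NeZero n] (R : CyclicSystem n) : Fin n → ℝ := R.phiC R.pc

/-- `δ = ∑ |e_i^i - e_i^{i⊖1}|`. -/
def delta [NeZero n] (R : CyclicSystem n) : ℝ := ∑ i, |R.el (i, false) - R.el (i - 1, true)|

end CyclicSystem

end

/-! In `±1` form the `2n` variables lie on one cycle whose edges alternate between bunches and
connections. The points of `𝔼` satisfy the odd cycle inequalities: every signed coordinate sum with
sign product `-1` is at most `2n - 2`. Indeed, at a deterministic outcome the product of all edge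
values is `1`, so odd signs leave at least one term `-1`, and `𝔼` consists of averages of such
outcomes (`sum_signs_mul_le_of_mem_polyE`). Conversely, these inequalities together with
`IsCorrelation` on every edge suffice for membership: cut the cycle open and build the path one
variable at a time, choosing at each stage a correlation between its two ends
(`pathRealizable_of_pathMax_le`, `exists_cycle_realization`).

The point `(e_b*, e_c*)` satisfies `IsCorrelation` on every edge, so contextuality means an excess
`d = s₁ - (2n - 2) > 0`. A functional with `±1` coefficients is 1-Lipschitz for `L₁`, hence no point
of `𝔼` is nearer than `d`. Shifting any single coordinate by `d` against its sign in a maximizing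
pattern lands in `𝔼` (`update_satisfies_cycle_inequalities`), so `d` is attained along every
coordinate. Since `φ` scales coordinate differences by 4, and a bunch (connection) shift keeps
`p_c*` (`p_b*`), all three measures equal `d / 4`. Finally, maximal connections force the sign `+`
on every connection, which gives the formula with `δ`. -/

/-! ### Correlations of two and three `±1`-variables -/

/-- `y` is the correlation of two `±1`-valued variables with expectations `a` and `b`. -/
def IsCorrelation (a b y : ℝ) : Prop := |a + b| - 1 ≤ y ∧ y ≤ 1 - |a - b|

theorem IsCorrelation.symm {a b y : ℝ} (h : IsCorrelation a b y) : IsCorrelation b a y := by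
  unfold IsCorrelation at *
  rwa [add_comm b a, abs_sub_comm b a]

theorem isCorrelation_iff {a b y : ℝ} :
    IsCorrelation a b y ↔
      0 ≤ 1 + a + b + y ∧ 0 ≤ 1 + a - b - y ∧ 0 ≤ 1 - a + b - y ∧ 0 ≤ 1 - a - b + y := by
  unfold IsCorrelation
  rw [sub_le_iff_le_add, le_sub_comm, abs_le, abs_le]
  constructor
  · rintro ⟨⟨_, _⟩, _, _⟩
    refine ⟨?_, ?_, ?_, ?_⟩ <;> linarith
  · rintro ⟨_, _, _, _⟩
    refine ⟨⟨?_, ?_⟩, ?_, ?_⟩ <;> linarith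

theorem IsCorrelation.abs_le_one {a b y : ℝ} (h : IsCorrelation a b y) : |y| ≤ 1 := by
  rw [isCorrelation_iff] at h
  obtain ⟨_, _, _, _⟩ := h
  rw [abs_le]
  constructor <;> linarith

/-- A third `±1`-variable can be adjoined to two given ones with prescribed expectation `d` and
correlations `x`, `y`; its conditional expectation is `α + β u + γ v + η u v`. -/
theorem exists_conditional_expectation {a b d x y z : ℝ}
    (hz : IsCorrelation a b z) (hx : IsCorrelation b d x) (hy : IsCorrelation a d y)
    (hxy : IsCorrelation x y z) :
    ∃ α β γ η : ℝ,
      (∀ u v : ℤˣ, |α + β * (u : ℤ) + γ * (v : ℤ) + η * ((u : ℤ) * (v : ℤ))| ≤ 1) ∧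
      α + β * a + γ * b + η * z = d ∧ α * b + β * z + γ + η * a = x ∧
      α * a + β + γ * z + η * b = y := by
  rw [isCorrelation_iff] at hz hx hy hxy
  obtain ⟨hz1, hz2, hz3, hz4⟩ := hz
  obtain ⟨hx1, hx2, hx3, hx4⟩ := hx
  obtain ⟨hy1, hy2, hy3, hy4⟩ := hy
  obtain ⟨hw1, hw2, hw3, hw4⟩ := hxy
  -- `t` is the free triple moment. The four atoms of the given pair have weights `(1 ± a ± b ± z) /
  -- 4`, and each confines `t` to an interval. The sixteen comparisons of lower with upper ends are
  -- exactly the sixteen hypotheses, so the largest lower end serves.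
  obtain ⟨t, ht⟩ : ∃ t : ℝ, |d + x + y + t| ≤ 1 + a + b + z ∧ |d - x + y - t| ≤ 1 + a - b - z ∧
      |d + x - y - t| ≤ 1 - a + b - z ∧ |d - x - y + t| ≤ 1 - a - b + z := by
    refine ⟨max (max (-(1 + a + b + z) - (d + x + y)) (-(1 - a - b + z) - (d - x - y)))
      (max (d - x + y - (1 + a - b - z)) (d + x - y - (1 - a + b - z))), ?_⟩
    generalize hT : (max (max _ _) (max _ _) : ℝ) = T
    have h1 := hT.le
    simp only [max_le_iff] at h1
    obtain ⟨⟨g1, g2⟩, g3, g4⟩ := h1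
    have key : ∀ B : ℝ, (-(1 + a + b + z) - (d + x + y)) ≤ B → (-(1 - a - b + z) - (d - x - y)) ≤ B →
        (d - x + y - (1 + a - b - z)) ≤ B → (d + x - y - (1 - a + b - z)) ≤ B → T ≤ B := by
      intro B _ _ _ _
      rw [← hT]
      simp only [max_le_iff]
      exact ⟨⟨‹_›, ‹_›⟩, ‹_›, ‹_›⟩
    have k1 := key (1 + a + b + z - (d + x + y)) (by linarith) (by linarith) (by linarith)
      (by linarith)
    have k2 := key (1 - a - b + z - (d - x - y)) (by linarith) (by linarith) (by linarith)
      (by linarith)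
    have k3 := key (1 + a - b - z + (d - x + y)) (by linarith) (by linarith) (by linarith)
      (by linarith)
    have k4 := key (1 - a + b - z + (d + x - y)) (by linarith) (by linarith) (by linarith)
      (by linarith)
    simp only [abs_le]
    refine ⟨⟨?_, ?_⟩, ⟨?_, ?_⟩, ⟨?_, ?_⟩, ?_, ?_⟩ <;> linarith
  obtain ⟨t1, t2, t3, t4⟩ := ht
  -- On an atom of weight zero the conditional expectation is arbitrary; `0` is taken.
  have hdiv : ∀ p q : ℝ, |p| ≤ q → ∃ c : ℝ, |c| ≤ 1 ∧ q * c = p := by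
    intro p q h
    rcases eq_or_ne q 0 with rfl | hq
    · exact ⟨0, by simp, by simpa using (abs_nonpos_iff.1 h).symm⟩
    · have hq' : 0 < q := lt_of_le_of_ne ((abs_nonneg p).trans h) hq.symm
      refine ⟨p / q, ?_, by field_simp⟩
      rw [abs_div, abs_of_pos hq', div_le_one hq']
      exact h
  obtain ⟨c1, hc1, e1⟩ := hdiv _ _ t1
  obtain ⟨c2, hc2, e2⟩ := hdiv _ _ t2
  obtain ⟨c3, hc3, e3⟩ := hdiv _ _ t3
  obtain ⟨c4, hc4, e4⟩ := hdiv _ _ t4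
  -- Fourier coefficients of the function with values `c1, …, c4` at `(1,1), (1,-1), (-1,1),
  -- (-1,-1)`.
  refine ⟨(c1 + c2 + c3 + c4) / 4, (c1 + c2 - c3 - c4) / 4, (c1 - c2 + c3 - c4) / 4,
    (c1 - c2 - c3 + c4) / 4, ?_, by linarith, by linarith, by linarith⟩
  intro u v
  rcases Int.units_eq_one_or u with rfl | rfl <;> rcases Int.units_eq_one_or v with rfl | rfl
  · convert hc1 using 2; push_cast; ring
  · convert hc2 using 2; push_cast; ring
  · convert hc3 using 2; push_cast; ring
  · convert hc4 using 2; push_cast; ring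

/-! ### Realizing a path of variables -/

/-- The sign of a truth value: `true` is `1` and `false` is `-1`. -/
def boolSign (b : Bool) : ℤˣ := if b then 1 else -1

/-- A finite probability space with `±1`-valued variables `X 0, …, X m` of expectations `a j`,
consecutive correlations `x j` and correlation `y` of the two ends. -/
def PathRealizable (a x : ℕ → ℝ) (m : ℕ) (y : ℝ) : Prop :=
  ∃ (Ω : Type) (_ : Fintype Ω) (p : Ω → ℝ) (X : ℕ → Ω → ℤˣ),
    (∀ ω, 0 ≤ p ω) ∧ ∑ ω, p ω = 1 ∧
    (∀ j ≤ m, ∑ ω, p ω * ((X j ω : ℤ) : ℝ) = a j) ∧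
    (∀ j < m, ∑ ω, p ω * (((X j ω : ℤ) : ℝ) * ((X (j + 1) ω : ℤ) : ℝ)) = x j) ∧
    ∑ ω, p ω * (((X 0 ω : ℤ) : ℝ) * ((X m ω : ℤ) : ℝ)) = y

theorem units_cast_mul_self (u : ℤˣ) : ((u : ℤ) : ℝ) * ((u : ℤ) : ℝ) = 1 := by
  rcases Int.units_eq_one_or u with rfl | rfl <;> simp

theorem PathRealizable.zero {a x : ℕ → ℝ} (ha : |a 0| ≤ 1) : PathRealizable a x 0 1 := by
  rw [abs_le] at ha
  refine ⟨Bool, inferInstance, fun b => (1 + (boolSign b : ℤ) * a 0) / 2, fun _ => boolSign,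
    ?_, ?_, ?_, ?_, ?_⟩
  · rintro (_ | _) <;> simp [boolSign] <;> linarith
  · simp [boolSign]; ring
  · intro j hj
    obtain rfl : j = 0 := by omega
    simp [boolSign]; ring
  · intro j hj; omega
  · simp [boolSign]; ring

/-- The new end is drawn with a conditional law depending only on the two old ends, so all old
moments survive and moments with the new variable are computed by replacing it with its conditional
expectation `c`. -/
theorem PathRealizable.succ {a x : ℕ → ℝ} {m : ℕ} {y z : ℝ} (h : PathRealizable a x m z)
    (hz : IsCorrelation (a 0) (a m) z) (hx : IsCorrelation (a m) (a (m + 1)) (x m))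
    (hy : IsCorrelation (a 0) (a (m + 1)) y) (hxy : IsCorrelation (x m) y z) :
    PathRealizable a x (m + 1) y := by
  obtain ⟨Ω, _, p, X, hp, h1, ha, he, h0⟩ := h
  obtain ⟨α, β, γ, η, hc, ed, ex, ey⟩ := exists_conditional_expectation hz hx hy hxy
  set c : Ω → ℝ := fun ω => α + β * ((X 0 ω : ℤ) : ℝ) + γ * ((X m ω : ℤ) : ℝ) +
    η * (((X 0 ω : ℤ) : ℝ) * ((X m ω : ℤ) : ℝ)) with hcdef
  have hc' : ∀ ω, |c ω| ≤ 1 := fun ω => hc _ _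
  have sum_old : ∀ f : Ω → ℝ, ∑ q : Ω × Bool,
      (p q.1 * (1 + ((boolSign q.2 : ℤ) : ℝ) * c q.1) / 2) * f q.1 = ∑ ω, p ω * f ω := by
    intro f
    rw [Fintype.sum_prod_type]
    refine Finset.sum_congr rfl fun ω _ => ?_
    simp [boolSign]; ring
  have sum_new : ∀ f : Ω → ℝ, ∑ q : Ω × Bool,
      (p q.1 * (1 + ((boolSign q.2 : ℤ) : ℝ) * c q.1) / 2) *
        (f q.1 * ((boolSign q.2 : ℤ) : ℝ)) = ∑ ω, p ω * (f ω * c ω) := by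
    intro f
    rw [Fintype.sum_prod_type]
    refine Finset.sum_congr rfl fun ω _ => ?_
    simp [boolSign]; ring
  refine ⟨Ω × Bool, inferInstance,
    fun q => p q.1 * (1 + ((boolSign q.2 : ℤ) : ℝ) * c q.1) / 2,
    fun j q => if j = m + 1 then boolSign q.2 else X j q.1, ?_, ?_, ?_, ?_, ?_⟩
  · rintro ⟨ω, b⟩
    have := abs_le.1 (hc' ω)
    refine div_nonneg (mul_nonneg (hp ω) ?_) zero_le_two
    cases b <;> simp [boolSign] <;> linarith
  · have := sum_old 1
    simpa [h1] using this
  · intro j hj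
    rcases eq_or_ne j (m + 1) with rfl | hne
    · have := sum_new 1
      simp only [Pi.one_apply, one_mul] at this
      simp only [if_true, this]
      rw [← ed, ← ha 0 (by omega), ← ha m le_rfl, ← h0]
      calc ∑ ω, p ω * c ω = α * ∑ ω, p ω + β * ∑ ω, p ω * ((X 0 ω : ℤ) : ℝ) +
          γ * ∑ ω, p ω * ((X m ω : ℤ) : ℝ) +
          η * ∑ ω, p ω * (((X 0 ω : ℤ) : ℝ) * ((X m ω : ℤ) : ℝ)) := by
            simp only [Finset.mul_sum, ← Finset.sum_add_distrib]
            refine Finset.sum_congr rfl fun ω _ => ?_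
            simp only [hcdef]; ring
        _ = _ := by rw [h1, mul_one]
    · simp only [if_neg hne]
      rw [sum_old fun ω => ((X j ω : ℤ) : ℝ)]
      exact ha j (by omega)
  · intro j hj
    have hne : j ≠ m + 1 := by omega
    rcases eq_or_ne j m with rfl | hjm
    · simp only [if_true, if_neg hne]
      rw [sum_new fun ω => ((X j ω : ℤ) : ℝ), ← ex, ← ha 0 (by omega), ← ha j le_rfl, ← h0]
      calc ∑ ω, p ω * (((X j ω : ℤ) : ℝ) * c ω)
          = α * ∑ ω, p ω * ((X j ω : ℤ) : ℝ) +
            β * ∑ ω, p ω * (((X 0 ω : ℤ) : ℝ) * ((X j ω : ℤ) : ℝ)) + γ * ∑ ω, p ω +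
            η * ∑ ω, p ω * ((X 0 ω : ℤ) : ℝ) := by
            simp only [Finset.mul_sum, ← Finset.sum_add_distrib]
            refine Finset.sum_congr rfl fun ω _ => ?_
            simp only [hcdef]
            linear_combination (p ω * (γ + η * ((X 0 ω : ℤ) : ℝ))) * units_cast_mul_self (X j ω)
        _ = _ := by rw [h1, mul_one]
    · have hne' : j + 1 ≠ m + 1 := by omega
      simp only [if_neg hne, if_neg hne']
      rw [sum_old fun ω => ((X j ω : ℤ) : ℝ) * ((X (j + 1) ω : ℤ) : ℝ)]
      exact he j (by omega)
  · have hne : 0 ≠ m + 1 := by omega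
    simp only [if_true, if_neg hne]
    rw [sum_new fun ω => ((X 0 ω : ℤ) : ℝ), ← ey, ← ha 0 (by omega), ← ha m le_rfl, ← h0]
    calc ∑ ω, p ω * (((X 0 ω : ℤ) : ℝ) * c ω)
        = α * ∑ ω, p ω * ((X 0 ω : ℤ) : ℝ) + β * ∑ ω, p ω +
          γ * ∑ ω, p ω * (((X 0 ω : ℤ) : ℝ) * ((X m ω : ℤ) : ℝ)) +
          η * ∑ ω, p ω * ((X m ω : ℤ) : ℝ) := by
          simp only [Finset.mul_sum, ← Finset.sum_add_distrib]
          refine Finset.sum_congr rfl fun ω _ => ?_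
          simp only [hcdef]
          linear_combination (p ω * (β + η * ((X m ω : ℤ) : ℝ))) * units_cast_mul_self (X 0 ω)
      _ = _ := by rw [h1, mul_one]

/-- `pathMax x m s` is the maximum of `∑ j < m, l j * x j` over the signs `l` of product `s`;
for `m = 0` and `s = -1` the value `-2` stands for the absent maximum. -/
def pathMax (x : ℕ → ℝ) : ℕ → ℤˣ → ℝ
  | 0, s => if s = 1 then 0 else -2
  | m + 1, s => max (pathMax x m s + x m) (pathMax x m (-s) - x m)

/-- Because `|x 0| ≤ 1`, the placeholder `-2` never wins in the first step of the recursion, so from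
one edge on the value is attained by actual signs. -/
theorem exists_signs_of_pathMax {x : ℕ → ℝ} (hx : |x 0| ≤ 1) (m : ℕ) (s : ℤˣ) :
    ∃ l : ℕ → ℤˣ, ∏ j ∈ Finset.range (m + 1), l j = s ∧
      ∑ j ∈ Finset.range (m + 1), ((l j : ℤ) : ℝ) * x j = pathMax x (m + 1) s := by
  induction m generalizing s with
  | zero =>
    refine ⟨fun _ => s, by simp, ?_⟩
    rw [abs_le] at hx
    rcases Int.units_eq_one_or s with rfl | rfl
    · simp [pathMax]; linarith
    · simp [pathMax]; linarith
  | succ m ih =>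
    have extend : ∀ (t u : ℤˣ), t * u = s → ∃ l : ℕ → ℤˣ, ∏ j ∈ Finset.range (m + 2), l j = s ∧
        ∑ j ∈ Finset.range (m + 2), ((l j : ℤ) : ℝ) * x j =
          pathMax x (m + 1) t + ((u : ℤ) : ℝ) * x (m + 1) := by
      intro t u htu
      obtain ⟨l, hl, hs⟩ := ih t
      have hlt : ∀ j ∈ Finset.range (m + 1), Function.update l (m + 1) u j = l j := by
        intro j hj
        rw [Finset.mem_range] at hj
        exact Function.update_of_ne (by omega) _ _
      refine ⟨Function.update l (m + 1) u, ?_, ?_⟩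
      · rw [Finset.prod_range_succ, Finset.prod_congr rfl hlt, hl, Function.update_self, htu]
      · rw [Finset.sum_range_succ, Function.update_self,
          Finset.sum_congr rfl fun j hj => by rw [hlt j hj], hs]
    rw [pathMax]
    rcases max_cases (pathMax x (m + 1) s + x (m + 1)) (pathMax x (m + 1) (-s) - x (m + 1)) with
      h | h
    · rw [h.1]
      simpa using extend s 1 (by simp)
    · rw [h.1]
      simpa [sub_eq_add_neg] using extend (-s) (-1) (by simp)

/-- These are the conditions for the interval that the cycle inequalities leave for the correlation
of the path's ends to be non-empty and to meet, bound against bound, the range allowed by their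
expectations. -/
theorem pathMax_le {a x : ℕ → ℝ} (ha : |a 0| ≤ 1)
    (hx : ∀ j, IsCorrelation (a j) (a (j + 1)) (x j)) (m : ℕ) :
    pathMax x m 1 + pathMax x m (-1) ≤ 2 * m - 2 ∧ pathMax x m 1 ≤ m - |a 0 - a m| ∧
      pathMax x m (-1) ≤ m - |a 0 + a m| := by
  induction m with
  | zero =>
    rw [abs_le] at ha
    have : (-1 : ℤˣ) ≠ 1 := by decide
    simp only [pathMax, if_true, if_neg this, Nat.cast_zero]
    refine ⟨by linarith, by simp, ?_⟩
    rw [le_sub_comm, abs_le]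
    constructor <;> linarith
  | succ m ih =>
    obtain ⟨h1, h2, h3⟩ := ih
    obtain ⟨g1, g2⟩ := hx m
    have t1 := abs_sub_le (a 0) (a m) (a (m + 1))
    have t2 := abs_add_le (a 0 - a m) (a m + a (m + 1))
    have t3 := abs_sub (a 0 + a m) (a m + a (m + 1))
    have t4 := abs_sub (a 0 + a m) (a m - a (m + 1))
    have e2 : a 0 - a m + (a m + a (m + 1)) = a 0 + a (m + 1) := by ring
    have e3 : a 0 + a m - (a m + a (m + 1)) = a 0 - a (m + 1) := by ring
    have e4 : a 0 + a m - (a m - a (m + 1)) = a 0 + a (m + 1) := by ring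
    rw [e2] at t2
    rw [e3] at t3
    rw [e4] at t4
    have p1 := abs_nonneg (a 0 - a m)
    have p2 := abs_nonneg (a 0 + a m)
    have p3 := abs_nonneg (a m + a (m + 1))
    have p4 := abs_nonneg (a m - a (m + 1))
    simp only [pathMax, neg_neg]
    push_cast
    refine ⟨?_, max_le ?_ ?_, max_le ?_ ?_⟩
    · rw [← le_sub_iff_add_le]
      refine max_le ?_ ?_ <;> rw [le_sub_comm] <;> refine max_le ?_ ?_ <;> linarith
    all_goals linarith

/-- A path with prescribed expectations and consecutive correlations is realizable with every
correlation of its ends that satisfies the cycle inequalities. -/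
theorem pathRealizable_of_pathMax_le {a x : ℕ → ℝ} (ha : |a 0| ≤ 1)
    (hx : ∀ j, IsCorrelation (a j) (a (j + 1)) (x j)) (m : ℕ) (y : ℝ)
    (hy : IsCorrelation (a 0) (a m) y) (h1 : pathMax x m 1 - y ≤ m - 1)
    (h2 : pathMax x m (-1) + y ≤ m - 1) : PathRealizable a x m y := by
  induction m generalizing y with
  | zero =>
    have := (abs_le.1 hy.abs_le_one).2
    -- Both ends are the same variable, and `h1` reads `-y ≤ -1`.
    obtain rfl : y = 1 := by
      simp [pathMax] at h1
      linarith
    exact PathRealizable.zero ha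
  | succ m ih =>
    obtain ⟨g1, g2, g3⟩ := pathMax_le ha hx m
    have hxm := isCorrelation_iff.1 (hx m)
    have hy' := isCorrelation_iff.1 hy
    have am : |a m| ≤ 1 := by
      rw [abs_le]; constructor <;> linarith
    rw [abs_le] at ha am
    simp only [pathMax, neg_neg] at h1 h2
    push_cast at h1 h2
    rw [sub_le_iff_le_add, max_le_iff] at h1
    rw [← le_sub_iff_add_le, max_le_iff] at h2
    -- `z` is the correlation along the chord from `0` to `m`, splitting the cycle into a shorter
    -- cycle and a triangle. It has three lower and three upper bounds; every lower one is below
    -- every upper one, so the largest lower bound works.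
    obtain ⟨z, hz1, hz2, hz3, hz4⟩ : ∃ z, IsCorrelation (a 0) (a m) z ∧
        IsCorrelation (x m) y z ∧ pathMax x m 1 - z ≤ m - 1 ∧ pathMax x m (-1) + z ≤ m - 1 := by
      have hxy : |x m + y| - 1 ≤ 1 - |x m - y| := by
        rcases abs_cases (x m + y) with h | h <;> rcases abs_cases (x m - y) with h' | h' <;>
          linarith
      have haa : |a 0 + a m| - 1 ≤ 1 - |a 0 - a m| := by
        rcases abs_cases (a 0 + a m) with h | h <;> rcases abs_cases (a 0 - a m) with h' | h' <;>
          linarith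
      have hxa : |x m + y| - 1 ≤ 1 - |a 0 - a m| := by
        rcases abs_cases (x m + y) with h | h <;> rcases abs_cases (a 0 - a m) with h' | h' <;>
          linarith
      have hax : |a 0 + a m| - 1 ≤ 1 - |x m - y| := by
        rcases abs_cases (a 0 + a m) with h | h <;> rcases abs_cases (x m - y) with h' | h' <;>
          linarith
      have hxp : |x m + y| - 1 ≤ m - 1 - pathMax x m (-1) := by
        rcases abs_cases (x m + y) with h | h <;> linarith
      have hpx : pathMax x m 1 - (m - 1) ≤ 1 - |x m - y| := by
        rcases abs_cases (x m - y) with h | h <;> linarith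
      refine ⟨max (max (|a 0 + a m| - 1) (|x m + y| - 1)) (pathMax x m 1 - (m - 1)),
        ⟨?_, ?_⟩, ⟨?_, ?_⟩, ?_, ?_⟩
      · exact le_max_of_le_left (le_max_left _ _)
      · refine max_le (max_le ?_ ?_) ?_ <;> linarith
      · exact le_max_of_le_left (le_max_right _ _)
      · refine max_le (max_le ?_ ?_) ?_ <;> linarith
      · rw [sub_le_comm]
        exact le_max_right _ _
      · rw [← le_sub_iff_add_le']
        refine max_le (max_le ?_ ?_) ?_ <;> linarith
    exact (ih z hz1 hz3 hz4).succ hz1 (hx m) hy hz2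

/-! ### Bounds on signed sums -/

/-- With `P_j` the product of the first `j` signs, each term is at most `1 - |P_j a_j - P_{j+1}
a_{j+1}|`; the triangle inequality telescopes. -/
theorem sum_signs_mul_le {a x : ℕ → ℝ} {l : ℕ → ℤˣ}
    (hx : ∀ j, IsCorrelation (a j) (a (j + 1)) (x j)) (m : ℕ) :
    ∑ j ∈ Finset.range m, ((l j : ℤ) : ℝ) * x j ≤
      m - |a 0 - (((∏ j ∈ Finset.range m, l j : ℤˣ) : ℤ) : ℝ) * a m| := by
  induction m with
  | zero => simp
  | succ m ih =>
    rw [Finset.sum_range_succ, Finset.prod_range_succ]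
    generalize ∏ j ∈ Finset.range m, l j = P at ih
    obtain ⟨h1, h2⟩ := hx m
    have h3 : ((l m : ℤ) : ℝ) * x m ≤ 1 - |(P : ℤ) * a m - ((P * l m : ℤˣ) : ℤ) * a (m + 1)| := by
      rcases Int.units_eq_one_or P with rfl | rfl <;>
        rcases Int.units_eq_one_or (l m) with h | h <;> rw [h] <;> simp
      · linarith
      · linarith
      · rw [abs_sub_comm] at h2
        rw [neg_add_eq_sub]
        linarith
      · rw [← abs_neg] at h1
        rw [← neg_add']
        linarith
    have h4 := abs_sub_le (a 0) ((P : ℤ) * a m) (((P * l m : ℤˣ) : ℤ) * a (m + 1))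
    push_cast at h3 h4 ⊢
    linarith

theorem units_sum_le_card_sub_two {ι : Type} [Fintype ι] {l : ι → ℤˣ} (hl : ∏ i, l i = -1) :
    ∑ i, ((l i : ℤ) : ℝ) ≤ Fintype.card ι - 2 := by
  classical
  obtain ⟨k, hk⟩ : ∃ k, l k = -1 := by
    by_contra! h
    have : ∏ i, l i = 1 :=
      Finset.prod_eq_one fun i _ => (Int.units_eq_one_or (l i)).resolve_right (h i)
    rw [this] at hl
    exact absurd hl (by decide)
  have h : ∑ i, (1 - ((l i : ℤ) : ℝ)) ≥ 1 - ((l k : ℤ) : ℝ) :=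
    Finset.single_le_sum (f := fun i => 1 - ((l i : ℤ) : ℝ)) (fun i _ => by
      rcases Int.units_eq_one_or (l i) with h | h <;> simp [h]) (Finset.mem_univ k)
  rw [Finset.sum_sub_distrib, hk] at h
  simp at h
  linarith

theorem sOne_spec {ι : Type} [Fintype ι] [DecidableEq ι] [Nonempty ι] (x : ι → ℝ) :
    IsGreatest ((fun l : ι → ℤˣ => ∑ i, ((l i : ℤ) : ℝ) * x i) '' {l | ∏ i, l i = -1})
      (sOne x) := by
  apply (Set.Finite.image _ (Set.toFinite _)).isCompact.isGreatest_sSup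
  refine Set.Nonempty.image _ ⟨Pi.mulSingle (Classical.arbitrary ι) (-1), ?_⟩
  exact Finset.prod_pi_mulSingle' .. |>.trans (by simp)

/-! ### The cycle of all `2n` variables -/

section Cycle

variable {n : ℕ} [NeZero n]

/-- The two variables joined by a bunch (`Sum.inl`) or a connection (`Sum.inr`), in the order in
which the cycle of all the variables passes through them. -/
def edgeSrc : Fin n ⊕ Fin n → CyclicVar n
  | .inl i => (i, false)
  | .inr i => (i - 1, true)

/-- The second of the two variables joined by a bunch or a connection; see `edgeSrc`. -/
def edgeTgt : Fin n ⊕ Fin n → CyclicVar n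
  | .inl i => (i, true)
  | .inr i => (i, false)

variable (n) in
/-- The `j`-th variable on the cycle. -/
def cycleVar (j : ℕ) : CyclicVar n := (Fin.ofNat n (j / 2), decide (j % 2 = 1))

variable (n) in
/-- The edge from the `j`-th variable on the cycle to the next one. -/
def cycleEdge (j : ℕ) : Fin n ⊕ Fin n :=
  if j % 2 = 0 then .inl (Fin.ofNat n (j / 2)) else .inr (Fin.ofNat n (j / 2) + 1)

theorem fin_ofNat_succ (i : ℕ) : Fin.ofNat n (i + 1) = Fin.ofNat n i + 1 := by
  ext
  simp [Fin.val_add]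

theorem edgeSrc_cycleEdge (j : ℕ) : edgeSrc (cycleEdge n j) = cycleVar n j := by
  unfold cycleEdge cycleVar
  split_ifs with h <;> simp [edgeSrc]
  · omega
  · omega

theorem edgeTgt_cycleEdge (j : ℕ) : edgeTgt (cycleEdge n j) = cycleVar n (j + 1) := by
  unfold cycleEdge cycleVar
  split_ifs with h
  · have h1 : (j + 1) / 2 = j / 2 := by omega
    have h2 : (j + 1) % 2 = 1 := by omega
    simp [edgeTgt, h1, h2]
  · have h1 : (j + 1) / 2 = j / 2 + 1 := by omega
    have h2 : (j + 1) % 2 ≠ 1 := by omega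
    rw [h1, fin_ofNat_succ]
    simp [edgeTgt, h2]

theorem cycleEdge_add (j : ℕ) : cycleEdge n (j + 2 * n) = cycleEdge n j := by
  have h1 : (j + 2 * n) % 2 = j % 2 := by omega
  have h2 : (j + 2 * n) / 2 = j / 2 + n := by omega
  have h3 : Fin.ofNat n (j / 2 + n) = Fin.ofNat n (j / 2) := by ext; simp
  simp only [cycleEdge, h1, h2, h3]

theorem cycleVar_add (j : ℕ) : cycleVar n (j + 2 * n) = cycleVar n j := by
  rw [← edgeSrc_cycleEdge, cycleEdge_add, edgeSrc_cycleEdge]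

/-- Any `2n` consecutive edges run through each edge once; by periodicity, sliding the window only
trades an edge for itself. -/
theorem prod_comp_cycleEdge {M : Type} [CommMonoid M] (f : Fin n ⊕ Fin n → M) (s : ℕ) :
    ∏ j ∈ Finset.range (2 * n), f (cycleEdge n (s + j)) = ∏ k, f k := by
  obtain ⟨N, hN⟩ : ∃ N, 2 * n = N + 1 :=
    ⟨2 * n - 1, by have := Nat.pos_of_neZero n; omega⟩
  induction s with
  | zero =>
    have h : ∀ m : ℕ, ∏ j ∈ Finset.range (2 * m), f (cycleEdge n (0 + j)) =
        ∏ i ∈ Finset.range m, (f (.inl (Fin.ofNat n i)) * f (.inr (Fin.ofNat n i + 1))) := by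
      intro m
      induction m with
      | zero => simp
      | succ m ih =>
        rw [Finset.prod_range_succ, ← ih, show 2 * (m + 1) = 2 * m + 1 + 1 by ring,
          Finset.prod_range_succ, Finset.prod_range_succ, mul_assoc]
        have h1 : (2 * m + 1) / 2 = m := by omega
        simp [cycleEdge, h1]
    rw [h, Finset.prod_range, Finset.prod_mul_distrib, Fintype.prod_sum_type]
    have h2 : ∀ i : Fin n, Fin.ofNat n (i : ℕ) = i := fun i => by simp
    simp only [h2]
    congr 1
    exact Equiv.prod_comp (Equiv.addRight (1 : Fin n)) fun i => f (.inr i)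
  | succ s ih =>
    rw [← ih, hN, Finset.prod_range_succ, Finset.prod_range_succ', add_zero,
      ← cycleEdge_add (n := n) s, hN]
    congr 1
    · refine Finset.prod_congr rfl fun j _ => ?_
      rw [add_right_comm, add_assoc]
    · rw [add_right_comm, add_assoc]

theorem sum_comp_cycleEdge {M : Type} [AddCommMonoid M] (f : Fin n ⊕ Fin n → M) (s : ℕ) :
    ∑ j ∈ Finset.range (2 * n), f (cycleEdge n (s + j)) = ∑ k, f k :=
  prod_comp_cycleEdge (M := Multiplicative M) f s

/-- Any edge can be made the last of a window of length `2n`, hence the place where the cycle is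
cut. -/
theorem exists_cycleEdge_eq (k : Fin n ⊕ Fin n) : ∃ s, cycleEdge n (s + (2 * n - 1)) = k := by
  have hn := Nat.pos_of_neZero n
  suffices h : ∃ j, cycleEdge n j = k by
    obtain ⟨j, rfl⟩ := h
    refine ⟨j + 1, ?_⟩
    rw [show j + 1 + (2 * n - 1) = j + 2 * n by omega, cycleEdge_add]
  rcases k with i | i
  · exact ⟨2 * (i : ℕ), by simp [cycleEdge]⟩
  · refine ⟨2 * ((i - 1 : Fin n) : ℕ) + 1, ?_⟩
    have h1 : (2 * ((i - 1 : Fin n) : ℕ) + 1) / 2 = ((i - 1 : Fin n) : ℕ) := by omega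
    simp [cycleEdge, h1]

/-- An odd signed sum of correlations along the cycle, cut at the edge `k`. -/
theorem sum_signs_mul_le_of_cut {a : CyclicVar n → ℝ} {x : Fin n ⊕ Fin n → ℝ}
    {l : Fin n ⊕ Fin n → ℤˣ} (hl : ∏ k, l k = -1)
    (k : Fin n ⊕ Fin n)
    (hx : ∀ k, IsCorrelation (a (edgeSrc k)) (a (edgeTgt k)) (x k)) :
    ∑ j, ((l j : ℤ) : ℝ) * x j ≤
      2 * n - 1 - |a (edgeSrc k) + ((l k : ℤ) : ℝ) * a (edgeTgt k)| + ((l k : ℤ) : ℝ) * x k := by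
  obtain ⟨s, rfl⟩ := exists_cycleEdge_eq k
  have hn := Nat.pos_of_neZero n
  obtain ⟨N, hN⟩ : ∃ N, 2 * n = N + 1 := ⟨2 * n - 1, by omega⟩
  rw [← prod_comp_cycleEdge l s, hN, Finset.prod_range_succ] at hl
  have key := sum_signs_mul_le (a := fun j => a (cycleVar n (s + j)))
    (x := fun j => x (cycleEdge n (s + j))) (l := fun j => l (cycleEdge n (s + j)))
    (fun j => by
      have := hx (cycleEdge n (s + j))
      rwa [edgeSrc_cycleEdge, edgeTgt_cycleEdge] at this) N
  rw [← sum_comp_cycleEdge (fun j => ((l j : ℤ) : ℝ) * x j) s, hN, Finset.sum_range_succ,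
    edgeSrc_cycleEdge, edgeTgt_cycleEdge, Nat.add_sub_cancel]
  have hv : cycleVar n (s + N + 1) = cycleVar n s := by
    rw [add_assoc, ← hN, cycleVar_add]
  rw [hv]
  have hN' : (2 * n : ℝ) = N + 1 := by exact_mod_cast hN
  generalize ∏ j ∈ Finset.range N, l (cycleEdge n (s + j)) = P at hl key
  simp only [add_zero] at key
  -- Oddness of all the signs makes `P` the opposite of the sign at the cut.
  have habs : |a (cycleVar n (s + N)) + ((l (cycleEdge n (s + N)) : ℤ) : ℝ) * a (cycleVar n s)| =
      |a (cycleVar n s) - ((P : ℤ) : ℝ) * a (cycleVar n (s + N))| := by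
    generalize l (cycleEdge n (s + N)) = q at hl
    rcases Int.units_eq_one_or P with rfl | rfl <;> rcases Int.units_eq_one_or q with rfl | rfl
    · exact absurd hl (by decide)
    · simp [← sub_eq_add_neg, abs_sub_comm]
    · simp [add_comm]
    · exact absurd hl (by decide)
  rw [habs, hN']
  linarith

/-- Without its last edge the cycle is a path through all the variables; the removed edge prescribes
the correlation of its ends. -/
theorem exists_cycle_realization {a : CyclicVar n → ℝ} {x : Fin n ⊕ Fin n → ℝ}
    (hx : ∀ k, IsCorrelation (a (edgeSrc k)) (a (edgeTgt k)) (x k))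
    (hl : ∀ l : Fin n ⊕ Fin n → ℤˣ, ∏ k, l k = -1 →
      ∑ k, ((l k : ℤ) : ℝ) * x k ≤ 2 * n - 2) :
    ∃ (Ω : Type) (_ : Fintype Ω) (p : Ω → ℝ) (X : CyclicVar n → Ω → ℤˣ),
      (∀ ω, 0 ≤ p ω) ∧ ∑ ω, p ω = 1 ∧ (∀ v, ∑ ω, p ω * ((X v ω : ℤ) : ℝ) = a v) ∧
      ∀ k, ∑ ω, p ω * (((X (edgeSrc k) ω : ℤ) : ℝ) * ((X (edgeTgt k) ω : ℤ) : ℝ)) = x k := by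
  have hn := Nat.pos_of_neZero n
  obtain ⟨M, hM⟩ : ∃ M, 2 * n = M + 1 + 1 := ⟨2 * n - 2, by omega⟩
  have hM' : (2 * n : ℝ) = M + 1 + 1 := by exact_mod_cast hM
  have hx' : ∀ j, IsCorrelation (a (cycleVar n j)) (a (cycleVar n (j + 1)))
      (x (cycleEdge n j)) := fun j => by
    have := hx (cycleEdge n j)
    rwa [edgeSrc_cycleEdge, edgeTgt_cycleEdge] at this
  have hv : cycleVar n (M + 1 + 1) = cycleVar n 0 := by
    rw [← hM, ← zero_add (2 * n), cycleVar_add]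
  -- Signs of product `s` on the path and `-s` on the removed edge form an odd pattern; `s = ±1`
  -- yields the two path conditions.
  have key : ∀ s : ℤˣ,
      pathMax (fun j => x (cycleEdge n j)) (M + 1) s - (s : ℤ) * x (cycleEdge n (M + 1)) ≤ M := by
    intro s
    obtain ⟨l, hl1, hl2⟩ := exists_signs_of_pathMax
      (x := fun j => x (cycleEdge n j)) (hx' 0).abs_le_one M s

    obtain ⟨L, hL⟩ : ∃ L : Fin n ⊕ Fin n → ℤˣ, ∀ j < 2 * n, L (cycleEdge n j) =
        if j = M + 1 then -s else l j := by
      -- The `Sum.elim` recovers the position of an edge, inverting `cycleEdge` on positions below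
      -- `2n`.
      refine ⟨fun k => if Sum.elim (fun i : Fin n => 2 * (i : ℕ))
        (fun i : Fin n => 2 * ((i - 1 : Fin n) : ℕ) + 1) k = M + 1 then -s else
        l (Sum.elim (fun i : Fin n => 2 * (i : ℕ))
          (fun i : Fin n => 2 * ((i - 1 : Fin n) : ℕ) + 1) k), ?_⟩
      intro j hj
      have : Sum.elim (fun i : Fin n => 2 * (i : ℕ))
          (fun i : Fin n => 2 * ((i - 1 : Fin n) : ℕ) + 1) (cycleEdge n j) = j := by
        have h1 : j / 2 % n = j / 2 := Nat.mod_eq_of_lt (by omega)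
        unfold cycleEdge
        split_ifs with h
        · simp [h1]; omega
        · simp [h1]; omega
      simp only [this]
    have hlt : ∀ j ∈ Finset.range (M + 1), L (cycleEdge n (0 + j)) = l j := by
      intro j hj
      rw [Finset.mem_range] at hj
      rw [zero_add, hL j (by omega), if_neg (by omega)]
    have hlast : L (cycleEdge n (0 + (M + 1))) = -s := by
      rw [zero_add, hL _ (by omega), if_pos rfl]
    have h := hl L (by
      rw [← prod_comp_cycleEdge L 0, hM, Finset.prod_range_succ, Finset.prod_congr rfl hlt, hl1,
        hlast]
      simp)
    rw [← sum_comp_cycleEdge (fun k => ((L k : ℤ) : ℝ) * x k) 0, hM, Finset.sum_range_succ,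
      Finset.sum_congr rfl fun j hj => by rw [hlt j hj], hlast, hM'] at h
    simp only [zero_add] at h
    rw [hl2] at h
    push_cast at h
    linarith
  have k1 := key 1
  have k2 := key (-1)
  have hlast := hx' (M + 1)
  rw [hv] at hlast
  have ha0 := isCorrelation_iff.1 (hx' 0)
  obtain ⟨Ω, _, p, X, hp, h1, ha, he, h0⟩ := pathRealizable_of_pathMax_le
    (a := fun j => a (cycleVar n j)) (x := fun j => x (cycleEdge n j))
    (by rw [abs_le]; constructor <;> linarith) hx' (M + 1) (x (cycleEdge n (M + 1))) hlast.symm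
    (by push_cast at k1 ⊢; linarith) (by push_cast at k2 ⊢; linarith)
  let idx : CyclicVar n → ℕ := fun v => 2 * (v.1 : ℕ) + if v.2 then 1 else 0
  have hidx : ∀ j < 2 * n, idx (cycleVar n j) = j := by
    intro j hj
    have h1 : j / 2 % n = j / 2 := Nat.mod_eq_of_lt (by omega)
    simp [idx, cycleVar, h1]
    split_ifs <;> omega
  have hidx' : ∀ v, cycleVar n (idx v) = v ∧ idx v ≤ M + 1 := by
    rintro ⟨i, b⟩
    have hi := i.2
    cases b
    · refine ⟨by simp [idx, cycleVar], ?_⟩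
      simp only [idx]
      norm_num
      omega
    · have h1 : (2 * (i : ℕ) + 1) / 2 = i := by omega
      refine ⟨by simp [idx, cycleVar, h1], ?_⟩
      simp only [idx]
      norm_num
      omega
  refine ⟨Ω, inferInstance, p, fun v => X (idx v), hp, h1, ?_, ?_⟩
  · intro v
    beta_reduce
    rw [ha _ (hidx' v).2]
    beta_reduce
    rw [(hidx' v).1]
  · intro k
    obtain ⟨j, hj, rfl⟩ : ∃ j < 2 * n, cycleEdge n j = k := by
      by_contra! hk
      -- An edge missed by the window would have its indicator sum to `0` instead of `1`.
      have hprod := sum_comp_cycleEdge (fun e => if e = k then (1 : ℕ) else 0) 0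
      rw [Finset.sum_eq_zero fun j hj => by
        rw [zero_add, if_neg (hk j (Finset.mem_range.1 hj))]] at hprod
      simp at hprod
    rw [edgeSrc_cycleEdge, edgeTgt_cycleEdge]
    beta_reduce
    rw [hidx j hj]
    rcases eq_or_ne j (M + 1) with rfl | hne
    · rw [hv, hidx 0 (by omega), ← h0]
      exact Finset.sum_congr rfl fun ω _ => by ring
    · rw [hidx (j + 1) (by omega)]
      exact he j (by omega)

/-! ### Shifting one coordinate -/

theorem sum_mul_update {ι : Type} [Fintype ι] [DecidableEq ι] (c x : ι → ℝ) (k : ι) (t : ℝ) :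
    ∑ j, c j * Function.update x k t j = ∑ j, c j * x j + c k * (t - x k) := by
  rw [← sub_eq_iff_eq_add', ← Finset.sum_sub_distrib,
    Finset.sum_eq_single k (fun j _ hj => by rw [Function.update_of_ne hj, sub_self])
      (fun h => absurd (Finset.mem_univ k) h), Function.update_self]
  ring

/-- Sign patterns of equal product disagree an even number of times, so at least twice here. Terms
cancel at disagreements and contribute at most `2` elsewhere. -/
theorem sum_add_sum_le_of_ne {ι : Type} [Fintype ι] [DecidableEq ι] {x : ι → ℝ}
    (hx : ∀ j, |x j| ≤ 1) {l l' : ι → ℤˣ} (h : ∏ j, l j = ∏ j, l' j) {k : ι} (hk : l' k ≠ l k) :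
    ∑ j, ((l j : ℤ) : ℝ) * x j + ∑ j, ((l' j : ℤ) : ℝ) * x j ≤ 2 * Fintype.card ι - 4 := by
  -- Erasing the disagreement at `k` leaves an odd number of others.
  have hq : ∏ j, Function.update (fun j => l j * l' j) k 1 j = -1 := by
    have h1 : ∏ j, l j * l' j = 1 := by rw [Finset.prod_mul_distrib, h, Int.units_mul_self]
    have h2 : l k * l' k = -1 := by
      rw [Int.units_ne_iff_eq_neg.1 hk, mul_neg, Int.units_mul_self]
    rw [Finset.prod_update_of_mem (Finset.mem_univ k), one_mul]
    rw [← Finset.mul_prod_erase _ _ (Finset.mem_univ k), h2, Finset.erase_eq] at h1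
    rw [← neg_eq_iff_eq_neg]
    simpa using h1
  have h1 := units_sum_le_card_sub_two hq
  have h2 : ∑ j, ((l j : ℤ) : ℝ) * x j + ∑ j, ((l' j : ℤ) : ℝ) * x j ≤
      ∑ j, (1 + ((Function.update (fun j => l j * l' j) k 1 j : ℤ) : ℝ) -
        if j = k then 2 else 0) := by
    rw [← Finset.sum_add_distrib]
    refine Finset.sum_le_sum fun j _ => ?_
    have hj := abs_le.1 (hx j)
    rcases eq_or_ne j k with rfl | hne
    · rw [Function.update_self, if_pos rfl]
      rw [Int.units_ne_iff_eq_neg.1 hk]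
      push_cast
      linarith
    · rw [Function.update_of_ne hne, if_neg hne]
      rcases Int.units_eq_one_or (l j) with h | h <;>
        rcases Int.units_eq_one_or (l' j) with h' | h' <;> rw [h, h'] <;> simp <;> linarith
  rw [Finset.sum_sub_distrib, Finset.sum_add_distrib] at h2
  simp at h2
  linarith

/-- A point violating the cycle inequalities is moved along one coordinate until they hold. -/
theorem update_satisfies_cycle_inequalities {a : CyclicVar n → ℝ} {x : Fin n ⊕ Fin n → ℝ}
    (hx : ∀ k, IsCorrelation (a (edgeSrc k)) (a (edgeTgt k)) (x k))
    {l : Fin n ⊕ Fin n → ℤˣ} (hl : ∏ k, l k = -1)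
    (hmax : ∀ l' : Fin n ⊕ Fin n → ℤˣ, ∏ k, l' k = -1 →
      ∑ k, ((l' k : ℤ) : ℝ) * x k ≤ ∑ k, ((l k : ℤ) : ℝ) * x k)
    {d : ℝ} (hd : ∑ k, ((l k : ℤ) : ℝ) * x k = 2 * n - 2 + d) (hd0 : 0 ≤ d)
    (k : Fin n ⊕ Fin n) :
    (∀ j, IsCorrelation (a (edgeSrc j)) (a (edgeTgt j))
      (Function.update x k (x k - ((l k : ℤ) : ℝ) * d) j)) ∧
    ∀ l' : Fin n ⊕ Fin n → ℤˣ, ∏ k, l' k = -1 →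
      ∑ j, ((l' j : ℤ) : ℝ) * Function.update x k (x k - ((l k : ℤ) : ℝ) * d) j ≤
        2 * n - 2 := by
  constructor
  · intro j
    rcases eq_or_ne j k with rfl | hne
    · rw [Function.update_self]
      -- The cut bound says precisely that the shift by `d` does not overshoot the far end of the
      -- correlation range.
      have h := sum_signs_mul_le_of_cut hl j hx
      obtain ⟨h1, h2⟩ := hx j
      rw [hd] at h
      rcases Int.units_eq_one_or (l j) with e | e <;> rw [e] at h ⊢
      · simp only [Units.val_one, Int.cast_one, one_mul] at h ⊢
        constructor <;> linarith
      · simp only [Units.val_neg, Units.val_one, Int.cast_neg, Int.cast_one, neg_mul, one_mul,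
          ← sub_eq_add_neg] at h ⊢
        constructor <;> linarith
    · rw [Function.update_of_ne hne]
      exact hx j
  · intro l' hl'
    rw [sum_mul_update, sub_sub_cancel_left]
    have h1 := hmax l' hl'
    by_cases hk : l' k = l k
    · rw [hk, mul_neg, ← mul_assoc, units_cast_mul_self]
      linarith
    -- This sum grows by `d`, but the two patterns together give at most `4n - 4`, so it was at most
    -- `2n - 2 - d`.
    · have h2 := sum_add_sum_le_of_ne (fun j => (hx j).abs_le_one) (hl.trans hl'.symm) hk
      have h3 : ((l' k : ℤ) : ℝ) = -((l k : ℤ) : ℝ) := by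
        rw [Int.units_ne_iff_eq_neg.1 hk]
        push_cast
        rfl
      rw [h3, neg_mul_neg, ← mul_assoc, units_cast_mul_self]
      rw [Fintype.card_sum, Fintype.card_fin] at h2
      push_cast at h2
      linarith

/-- Each variable is the source of one edge and the target of one edge, so its sign occurs squared.
-/
theorem prod_edge_mul (σ : CyclicVar n → ℤˣ) :
    ∏ k, σ (edgeSrc k) * σ (edgeTgt k) = 1 := by
  rw [Fintype.prod_sum_type]
  simp only [edgeSrc, edgeTgt, Finset.prod_mul_distrib]
  have h : ∏ i : Fin n, σ (i - 1, true) = ∏ i : Fin n, σ (i, true) :=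
    Equiv.prod_comp (Equiv.subRight (1 : Fin n)) fun i => σ (i, true)
  rw [h, mul_mul_mul_comm, mul_comm (∏ i : Fin n, σ (i, true)), Int.units_mul_self]

end Cycle

/-! ### From `0/1` products to `±1` correlations -/

theorem incidence_single {n : ℕ} (v : CyclicVar n) (r : CyclicOutcome n) :
    incidence {v} r = (1 + ((boolSign (r v) : ℤ) : ℝ)) / 2 := by
  cases h : r v <;> simp [incidence, boolSign, h]

theorem incidence_pair {n : ℕ} (u v : CyclicVar n) (r : CyclicOutcome n) :
    incidence {u, v} r = (1 + ((boolSign (r u) : ℤ) : ℝ) + ((boolSign (r v) : ℤ) : ℝ) +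
      ((boolSign (r u) : ℤ) : ℝ) * ((boolSign (r v) : ℤ) : ℝ)) / 4 := by
  cases h : r u <;> cases h' : r v <;> simp [incidence, boolSign, h, h'] <;> norm_num

theorem prodExpect_eq_sum {n : ℕ} (g : CyclicOutcome n → ℝ) (A : Finset (CyclicVar n)) :
    prodExpect g A = ∑ r, incidence A r * g r := by
  simp [prodExpect, incidence, Finset.sum_filter]

namespace CyclicSystem

theorem abs_el_le_one {n : ℕ} (R : CyclicSystem n) (v : CyclicVar n) : |R.el v| ≤ 1 := by
  obtain ⟨i, b⟩ := v
  obtain ⟨h0, h1⟩ := R.bunch_mem i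
  simp only [Fintype.sum_prod_type, Fintype.sum_bool] at h1
  have := h0 (true, true)
  have := h0 (true, false)
  have := h0 (false, true)
  have := h0 (false, false)
  rw [abs_le]
  cases b <;> simp only [el, marg] <;> constructor <;> linarith

variable {n : ℕ} [NeZero n] (R : CyclicSystem n)

theorem phi_apply (p : Fin n ⊕ Fin n → ℝ) (k : Fin n ⊕ Fin n) :
    R.phi p k = 4 * p k - 2 * R.marg (edgeSrc k) - 2 * R.marg (edgeTgt k) + 1 := by
  rcases k with i | i
  · rfl
  · simp only [phi, phiC, edgeSrc, edgeTgt, Sum.elim_inr]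
    ring

theorem phi_elim_pb_pc : R.phi (Sum.elim R.pb R.pc) = Sum.elim R.eb R.ec := rfl

theorem phi_sub_phi (p q : Fin n ⊕ Fin n → ℝ) (k : Fin n ⊕ Fin n) :
    R.phi p k - R.phi q k = 4 * (p k - q k) := by
  rw [phi_apply, phi_apply]
  ring

/-- `h` is the joint distribution of `2n` variables which, relabeled to `±1`, have the
expectations `e_j^i` and the correlations `y`. -/
def IsSignedCoupling (h : CyclicOutcome n → ℝ) (y : Fin n ⊕ Fin n → ℝ) : Prop :=
  (∀ r, 0 ≤ h r) ∧ ∑ r, h r = 1 ∧ (∀ v, ∑ r, h r * ((boolSign (r v) : ℤ) : ℝ) = R.el v) ∧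
    ∀ k, ∑ r, h r * (((boolSign (r (edgeSrc k)) : ℤ) : ℝ) *
      ((boolSign (r (edgeTgt k)) : ℤ) : ℝ)) = y k

/-- An indicator is `(1 + u) / 2` with `u` the sign, so expanding products turns the matrix
equations into an invertible affine system for the signed moments. -/
theorem isSignedCoupling_iff (h : CyclicOutcome n → ℝ) (p : Fin n ⊕ Fin n → ℝ) :
    R.IsSignedCoupling h (R.phi p) ↔ (∀ r, 0 ≤ h r) ∧ matL n *ᵥ h = R.pl ∧
      (matB n *ᵥ h = fun i => p (Sum.inl i)) ∧ matC n *ᵥ h = fun i => p (Sum.inr i) := by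
  have hnone : (matL n *ᵥ h) none = ∑ r, h r := by
    simp [Matrix.mulVec, dotProduct, matL, incidence]
  have hsome : ∀ v, (matL n *ᵥ h) (some v) =
      (∑ r, h r + ∑ r, h r * ((boolSign (r v) : ℤ) : ℝ)) / 2 := by
    intro v
    simp only [Matrix.mulVec, dotProduct, matL, Option.toFinset_some, incidence_single]
    rw [← Finset.sum_add_distrib, Finset.sum_div]
    exact Finset.sum_congr rfl fun r _ => by ring
  have hpair : ∀ u v, ∑ r, incidence {u, v} r * h r =
      (∑ r, h r + ∑ r, h r * ((boolSign (r u) : ℤ) : ℝ) + ∑ r, h r * ((boolSign (r v) : ℤ) : ℝ) +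
        ∑ r, h r * (((boolSign (r u) : ℤ) : ℝ) * ((boolSign (r v) : ℤ) : ℝ))) / 4 := by
    intro u v
    simp only [incidence_pair]
    rw [← Finset.sum_add_distrib, ← Finset.sum_add_distrib, ← Finset.sum_add_distrib,
      Finset.sum_div]
    exact Finset.sum_congr rfl fun r _ => by ring
  have hB : ∀ i, (matB n *ᵥ h) i = ∑ r, incidence {edgeSrc (Sum.inl i), edgeTgt (Sum.inl i)} r *
      h r := fun i => rfl
  have hC : ∀ i, (matC n *ᵥ h) i = ∑ r, incidence {edgeSrc (Sum.inr i), edgeTgt (Sum.inr i)} r *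
      h r := fun i => by
    rw [Finset.pair_comm]
    rfl
  unfold IsSignedCoupling
  refine and_congr_right fun _ => ?_
  constructor
  · rintro ⟨h1, h2, h3⟩
    have hk : ∀ k, ∑ r, incidence {edgeSrc k, edgeTgt k} r * h r = p k := by
      intro k
      rw [hpair, h1, h2, h2, h3, phi_apply, el, el]
      ring
    refine ⟨?_, ?_, ?_⟩
    · funext v
      rcases v with _ | v
      · rw [hnone, h1]; rfl
      · rw [hsome, h1, h2, pl, el]
        ring
    · funext i
      rw [hB, hk]
    · funext i
      rw [hC, hk]
  · rintro ⟨h1, h2, h3⟩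
    have g1 : ∑ r, h r = 1 := by rw [← hnone, h1]; rfl
    have g2 : ∀ v, ∑ r, h r * ((boolSign (r v) : ℤ) : ℝ) = R.el v := by
      intro v
      have := hsome v
      rw [h1, g1, pl] at this
      rw [el]
      linarith
    have hk : ∀ k, ∑ r, incidence {edgeSrc k, edgeTgt k} r * h r = p k := by
      rintro (i | i)
      · rw [← hB, h2]
      · rw [← hC, h3]
    refine ⟨g1, g2, fun k => ?_⟩
    have := hpair (edgeSrc k) (edgeTgt k)
    rw [hk, g1, g2, g2, el, el] at this
    rw [phi_apply]
    linarith

theorem mem_polyE_iff (y : Fin n ⊕ Fin n → ℝ) :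
    y ∈ R.polyE ↔ ∃ h, R.IsSignedCoupling h y := by
  constructor
  · rintro ⟨p, ⟨h, hp⟩, rfl⟩
    exact ⟨h, (R.isSignedCoupling_iff h p).2 hp⟩
  · rintro ⟨h, hh⟩
    obtain ⟨p, rfl⟩ : ∃ p, R.phi p = y :=
      ⟨fun k => (y k + 2 * R.marg (edgeSrc k) + 2 * R.marg (edgeTgt k) - 1) / 4, by
        funext k
        rw [phi_apply]
        ring⟩
    exact ⟨p, ⟨h, (R.isSignedCoupling_iff h p).1 hh⟩, rfl⟩

/-! ### Cycle inequalities and membership in `𝔼` -/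

theorem sum_signs_mul_le_of_mem_polyE {y : Fin n ⊕ Fin n → ℝ} (hy : y ∈ R.polyE)
    {l : Fin n ⊕ Fin n → ℤˣ} (hl : ∏ k, l k = -1) :
    ∑ k, ((l k : ℤ) : ℝ) * y k ≤ 2 * n - 2 := by
  obtain ⟨h, h0, h1, -, h3⟩ := (R.mem_polyE_iff y).1 hy
  calc ∑ k, ((l k : ℤ) : ℝ) * y k
      = ∑ r, h r * ∑ k, (((l k * (boolSign (r (edgeSrc k)) * boolSign (r (edgeTgt k))) : ℤˣ) :
          ℤ) : ℝ) := by
        simp only [← h3, Finset.mul_sum]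
        rw [Finset.sum_comm]
        refine Finset.sum_congr rfl fun r _ => Finset.sum_congr rfl fun k _ => ?_
        push_cast
        ring
    _ ≤ ∑ r, h r * (2 * n - 2) := by
        refine Finset.sum_le_sum fun r _ => mul_le_mul_of_nonneg_left ?_ (h0 r)
        refine (units_sum_le_card_sub_two ?_).trans (by simp; linarith)
        rw [Finset.prod_mul_distrib, hl, prod_edge_mul fun v => boolSign (r v), mul_one]
    _ = 2 * n - 2 := by rw [← Finset.sum_mul, h1, one_mul]

theorem mem_polyE_of_sum_signs_mul_le {y : Fin n ⊕ Fin n → ℝ}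
    (hy : ∀ k, IsCorrelation (R.el (edgeSrc k)) (R.el (edgeTgt k)) (y k))
    (hl : ∀ l : Fin n ⊕ Fin n → ℤˣ, ∏ k, l k = -1 →
      ∑ k, ((l k : ℤ) : ℝ) * y k ≤ 2 * n - 2) : y ∈ R.polyE := by
  classical
  obtain ⟨Ω, _, p, X, hp, h1, h2, h3⟩ := exists_cycle_realization hy hl
  rw [mem_polyE_iff]
  let out : Ω → CyclicOutcome n := fun ω v => decide (X v ω = 1)
  have hout : ∀ ω v, boolSign (out ω v) = X v ω := by
    intro ω v
    rcases Int.units_eq_one_or (X v ω) with h | h <;> simp [out, boolSign, h]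
  -- The coupling is the push-forward of `p` to the outcomes; this is its change of variables.
  have hsum : ∀ F : CyclicOutcome n → ℝ,
      ∑ r, (∑ ω with out ω = r, p ω) * F r = ∑ ω, p ω * F (out ω) := by
    intro F
    rw [← Finset.sum_fiberwise Finset.univ out]
    refine Finset.sum_congr rfl fun r _ => ?_
    rw [Finset.sum_mul]
    refine Finset.sum_congr rfl fun ω hω => ?_
    rw [(Finset.mem_filter.1 hω).2]
  refine ⟨fun r => ∑ ω with out ω = r, p ω, fun r => Finset.sum_nonneg fun ω _ => hp ω, ?_, ?_, ?_⟩
  · simpa [h1] using hsum 1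
  · intro v
    rw [hsum fun r => ((boolSign (r v) : ℤ) : ℝ), ← h2]
    simp only [hout]
  · intro k
    rw [hsum fun r => ((boolSign (r (edgeSrc k)) : ℤ) : ℝ) * ((boolSign (r (edgeTgt k)) : ℤ) : ℝ),
      ← h3]
    simp only [hout]

/-! ### The point of a contextual system and its distances -/

theorem ec_eq (i : Fin n) : R.ec i = 1 - |R.el (i, false) - R.el (i - 1, true)| := by
  simp only [ec, phiC, pc, el]
  rcases le_total (R.marg (i, false)) (R.marg (i - 1, true)) with h | h
  · rw [min_eq_left h, abs_of_nonpos (by linarith)]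
    ring
  · rw [min_eq_right h, abs_of_nonneg (by linarith)]
    ring

theorem isCorrelation_elim_eb_ec (k : Fin n ⊕ Fin n) :
    IsCorrelation (R.el (edgeSrc k)) (R.el (edgeTgt k)) (Sum.elim R.eb R.ec k) := by
  rcases k with i | i
  · obtain ⟨h0, h1⟩ := R.bunch_mem i
    simp only [Fintype.sum_prod_type, Fintype.sum_bool] at h1
    have := h0 (true, true)
    have := h0 (true, false)
    have := h0 (false, true)
    have := h0 (false, false)
    rw [isCorrelation_iff]
    simp only [edgeSrc, edgeTgt, el, marg, Sum.elim_inl, eb, phiB, pb]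
    refine ⟨?_, ?_, ?_, ?_⟩ <;> linarith
  · have h1 := abs_le.1 (R.abs_el_le_one (i, false))
    have h2 := abs_le.1 (R.abs_el_le_one (i - 1, true))
    refine IsCorrelation.symm ?_
    simp only [edgeSrc, edgeTgt, Sum.elim_inr, ec_eq]
    refine ⟨?_, le_rfl⟩
    rcases abs_cases (R.el (i, false) + R.el (i - 1, true)) with h | h <;>
      rcases abs_cases (R.el (i, false) - R.el (i - 1, true)) with h' | h' <;> linarith

theorem Contextual.notMem_polyE {R : CyclicSystem n} (hR : R.Contextual) :
    Sum.elim R.eb R.ec ∉ R.polyE := by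
  intro h
  obtain ⟨g, hg⟩ := (R.mem_polyE_iff _).1 h
  rw [← phi_elim_pb_pc] at hg
  have h1 := hg.2.1
  obtain ⟨h0, hl, hb, hc⟩ := (R.isSignedCoupling_iff _ _).1 hg
  refine hR ⟨g, ⟨⟨h0, h1⟩, fun v => ?_, fun i => ?_⟩, fun i => ?_⟩ <;> rw [prodExpect_eq_sum]
  · exact congrFun hl (some v)
  · exact congrFun hb i
  · exact congrFun hc i

/-- The odd signs at which a contextual system violates the cycle inequalities. -/
theorem Contextual.exists_signs {R : CyclicSystem n} (hR : R.Contextual) :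
    ∃ l : Fin n ⊕ Fin n → ℤˣ, ∏ k, l k = -1 ∧
      ∑ k, ((l k : ℤ) : ℝ) * Sum.elim R.eb R.ec k = sOne (Sum.elim R.eb R.ec) ∧
      (2 * n - 2 : ℝ) < sOne (Sum.elim R.eb R.ec) := by
  obtain ⟨⟨l, hl, hs⟩, hub⟩ := sOne_spec (Sum.elim R.eb R.ec)
  refine ⟨l, hl, hs, ?_⟩
  by_contra! h
  exact hR.notMem_polyE (R.mem_polyE_of_sum_signs_mul_le R.isCorrelation_elim_eb_ec
    fun l' hl' => (hub ⟨l', hl', rfl⟩).trans h)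

/-- Each `e_c*` coordinate sits at the upper end of its correlation range. A sign `-1` there would,
by the cut bound, make the maximal sum at most `2n - 2`, contrary to contextuality. -/
theorem Contextual.sOne_eq {R : CyclicSystem n} (hR : R.Contextual) :
    sOne (Sum.elim R.eb R.ec) = sOne R.eb + n - R.delta := by
  have hsum : ∑ i, R.ec i = n - R.delta := by
    simp [ec_eq, delta, Finset.sum_sub_distrib]
  obtain ⟨l, hl, hs, hlt⟩ := hR.exists_signs
  have hone : ∀ i, l (Sum.inr i) = 1 := by
    intro i
    by_contra hne
    have hneg := (Int.units_eq_one_or (l (Sum.inr i))).resolve_left hne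
    have h := sum_signs_mul_le_of_cut hl (Sum.inr i) R.isCorrelation_elim_eb_ec
    rw [hs, hneg] at h
    simp only [edgeSrc, edgeTgt, Sum.elim_inr, ec_eq] at h
    rw [abs_sub_comm (R.el (i, false))] at h
    simp [← sub_eq_add_neg] at h
    linarith
  apply le_antisymm
  · rw [← hs, Fintype.sum_sum_type]
    rw [Fintype.prod_sum_type] at hl
    simp only [hone, Finset.prod_const_one, mul_one] at hl
    have := (sOne_spec R.eb).2 ⟨fun i => l (Sum.inl i), hl, rfl⟩
    simp [hone, hsum]
    simp at this
    linarith
  · obtain ⟨⟨m, hm, hms⟩, -⟩ := sOne_spec R.eb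
    have := (sOne_spec (Sum.elim R.eb R.ec)).2 ⟨Sum.elim m 1, by simpa using hm, rfl⟩
    simp [hsum] at this
    simp at hms
    linarith

theorem Contextual.exists_mem_alongCoord {R : CyclicSystem n} (hR : R.Contextual)
    (k : Fin n ⊕ Fin n) :
    ∃ y ∈ alongCoord k (Sum.elim R.eb R.ec) R.polyE,
      ∑ j, |Sum.elim R.eb R.ec j - y j| = sOne (Sum.elim R.eb R.ec) - (2 * (n : ℝ) - 2) := by
  obtain ⟨l, hl, hs, hlt⟩ := hR.exists_signs
  set x := Sum.elim R.eb R.ec with hx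
  set d := sOne x - (2 * (n : ℝ) - 2) with hd
  have hd0 : 0 < d := by linarith
  obtain ⟨h1, h2⟩ := update_satisfies_cycle_inequalities R.isCorrelation_elim_eb_ec hl
    (fun l' hl' => by
      rw [← hx, hs]
      exact (sOne_spec x).2 ⟨l', hl', rfl⟩) (d := d) (by rw [← hx, hs]; ring) hd0.le k
  refine ⟨_, ⟨R.mem_polyE_of_sum_signs_mul_le h1 h2, fun j hj => Function.update_of_ne hj _ _⟩, ?_⟩
  rw [Finset.sum_eq_single k (fun j _ hj => by rw [Function.update_of_ne hj, sub_self, abs_zero])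
    (fun h => absurd (Finset.mem_univ k) h), Function.update_self, sub_sub_cancel, abs_mul,
    abs_of_pos hd0]
  rcases Int.units_eq_one_or (l k) with h | h <;> simp [h]

theorem sOne_sub_le_sum_abs_sub (x : Fin n ⊕ Fin n → ℝ) {y : Fin n ⊕ Fin n → ℝ}
    (hy : y ∈ R.polyE) : sOne x - (2 * (n : ℝ) - 2) ≤ ∑ j, |x j - y j| := by
  obtain ⟨⟨l, hl, hs⟩, -⟩ := sOne_spec x
  have h1 := R.sum_signs_mul_le_of_mem_polyE hy hl
  have h2 : ∑ k, ((l k : ℤ) : ℝ) * x k - ∑ k, ((l k : ℤ) : ℝ) * y k ≤ ∑ j, |x j - y j| := by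
    rw [← Finset.sum_sub_distrib]
    refine Finset.sum_le_sum fun j _ => ?_
    rw [← mul_sub]
    rcases Int.units_eq_one_or (l j) with h | h <;> simp only [h]
    · simpa using le_abs_self (x j - y j)
    · simpa using neg_le_abs (x j - y j)
  simp only at hs
  linarith

theorem sum_abs_phi_sub_phi (p q : Fin n ⊕ Fin n → ℝ) :
    ∑ j, |R.phi p j - R.phi q j| = 4 * ∑ j, |p j - q j| := by
  rw [Finset.mul_sum]
  exact Finset.sum_congr rfl fun j _ => by rw [phi_sub_phi, abs_mul, abs_of_pos four_pos]

theorem Contextual.exists_mem_polyP {R : CyclicSystem n} (hR : R.Contextual)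
    (k : Fin n ⊕ Fin n) :
    ∃ p ∈ alongCoord k (Sum.elim R.pb R.pc) R.polyP, ∑ j, |Sum.elim R.pb R.pc j - p j| =
      1 / 4 * (sOne (Sum.elim R.eb R.ec) - (2 * (n : ℝ) - 2)) := by
  obtain ⟨_, ⟨⟨p, hp, rfl⟩, hk⟩, h⟩ := hR.exists_mem_alongCoord k
  rw [← phi_elim_pb_pc] at hk
  refine ⟨p, ⟨hp, fun j hj => ?_⟩, ?_⟩
  · have := R.phi_sub_phi p (Sum.elim R.pb R.pc) j
    rw [hk j hj] at this
    linarith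
  · rw [← h, ← phi_elim_pb_pc, sum_abs_phi_sub_phi]
    ring

theorem sOne_sub_le_of_mem_polyP {p : Fin n ⊕ Fin n → ℝ} (hp : p ∈ R.polyP) :
    1 / 4 * (sOne (Sum.elim R.eb R.ec) - (2 * (n : ℝ) - 2)) ≤
      ∑ j, |Sum.elim R.pb R.pc j - p j| := by
  have := R.sOne_sub_le_sum_abs_sub (Sum.elim R.eb R.ec) ⟨p, hp, rfl⟩
  rw [← phi_elim_pb_pc, sum_abs_phi_sub_phi, phi_elim_pb_pc] at this
  linarith

theorem mem_polyPb_iff (p : Fin n → ℝ) : p ∈ R.polyPb ↔ Sum.elim p R.pc ∈ R.polyP := Iff.rfl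

theorem mem_polyPc_iff (p : Fin n → ℝ) : p ∈ R.polyPc ↔ Sum.elim R.pb p ∈ R.polyP := Iff.rfl

theorem Contextual.isLeast_polyE {R : CyclicSystem n} (hR : R.Contextual) :
    IsLeast (lOneDistances (Sum.elim R.eb R.ec) R.polyE)
      (sOne (Sum.elim R.eb R.ec) - (2 * (n : ℝ) - 2)) := by
  obtain ⟨y, hy, h⟩ := hR.exists_mem_alongCoord (Sum.inl 0)
  refine ⟨⟨y, hy.1, h⟩, ?_⟩
  rintro _ ⟨z, hz, rfl⟩
  exact R.sOne_sub_le_sum_abs_sub _ hz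

theorem Contextual.isLeast_alongCoord {R : CyclicSystem n} (hR : R.Contextual)
    (k : Fin n ⊕ Fin n) :
    IsLeast (lOneDistances (Sum.elim R.eb R.ec) (alongCoord k (Sum.elim R.eb R.ec) R.polyE))
      (sOne (Sum.elim R.eb R.ec) - (2 * (n : ℝ) - 2)) := by
  obtain ⟨y, hy, h⟩ := hR.exists_mem_alongCoord k
  refine ⟨⟨y, hy, h⟩, ?_⟩
  rintro _ ⟨z, hz, rfl⟩
  exact R.sOne_sub_le_sum_abs_sub _ hz.1

theorem Contextual.isLeast_polyP {R : CyclicSystem n} (hR : R.Contextual) :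
    IsLeast (lOneDistances (Sum.elim R.pb R.pc) R.polyP)
      (1 / 4 * (sOne (Sum.elim R.eb R.ec) - (2 * (n : ℝ) - 2))) := by
  obtain ⟨y, hy, h⟩ := hR.exists_mem_polyP (Sum.inl 0)
  refine ⟨⟨y, hy.1, h⟩, ?_⟩
  rintro _ ⟨z, hz, rfl⟩
  exact R.sOne_sub_le_of_mem_polyP hz

/-- A shift along a bunch coordinate keeps `p_c*`, so the minimum over `ℙ` is already attained on
the slice `ℙ_b`; the lower bound is inherited. -/
theorem Contextual.isLeast_polyPb {R : CyclicSystem n} (hR : R.Contextual) :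
    IsLeast (lOneDistances R.pb R.polyPb)
      (1 / 4 * (sOne (Sum.elim R.eb R.ec) - (2 * (n : ℝ) - 2))) := by
  obtain ⟨p, ⟨hp, hk⟩, h⟩ := hR.exists_mem_polyP (Sum.inl 0)
  have hc : ∀ i, p (Sum.inr i) = R.pc i := fun i => hk (Sum.inr i) (by simp)
  refine ⟨⟨fun i => p (Sum.inl i), ?_, ?_⟩, ?_⟩
  · rw [mem_polyPb_iff]
    convert hp using 1
    funext j
    rcases j with i | i <;> simp [hc]
  · rw [← h, Fintype.sum_sum_type]
    simp [hc]
  · rintro _ ⟨z, hz, rfl⟩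
    simpa [Fintype.sum_sum_type] using R.sOne_sub_le_of_mem_polyP ((R.mem_polyPb_iff z).1 hz)

theorem Contextual.isLeast_polyPc {R : CyclicSystem n} (hR : R.Contextual) :
    IsLeast (lOneDistances R.pc R.polyPc)
      (1 / 4 * (sOne (Sum.elim R.eb R.ec) - (2 * (n : ℝ) - 2))) := by
  obtain ⟨p, ⟨hp, hk⟩, h⟩ := hR.exists_mem_polyP (Sum.inr 0)
  have hb : ∀ i, p (Sum.inl i) = R.pb i := fun i => hk (Sum.inl i) (by simp)
  refine ⟨⟨fun i => p (Sum.inr i), ?_, ?_⟩, ?_⟩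
  · rw [mem_polyPc_iff]
    convert hp using 1
    funext j
    rcases j with i | i <;> simp [hb]
  · rw [← h, Fintype.sum_sum_type]
    simp [hb]
  · rintro _ ⟨z, hz, rfl⟩
    simpa [Fintype.sum_sum_type] using R.sOne_sub_le_of_mem_polyP ((R.mem_polyPc_iff z).1 hz)

end CyclicSystem

theorem mainTheorem3 (n : ℕ) [NeZero n] (hn : 2 ≤ n) (R : CyclicSystem n)
    (hR : R.Contextual) :
    IsLeast (lOneDistances (Sum.elim R.eb R.ec) R.polyE)
        (sOne (Sum.elim R.eb R.ec) - (2 * (n : ℝ) - 2)) ∧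
      (∀ k : Fin n ⊕ Fin n,
        IsLeast
          (lOneDistances (Sum.elim R.eb R.ec) (alongCoord k (Sum.elim R.eb R.ec) R.polyE))
          (sOne (Sum.elim R.eb R.ec) - (2 * (n : ℝ) - 2))) ∧
      R.CNT0 = (1 / 4) * lOneDist (Sum.elim R.eb R.ec) R.polyE ∧
      R.CNT0 = (1 / 4) * (sOne (Sum.elim R.eb R.ec) - (2 * (n : ℝ) - 2)) ∧
      R.polyPc.Nonempty ∧ R.polyPb.Nonempty ∧
      R.CNT0 = R.CNT1 ∧ R.CNT1 = R.CNT2 ∧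
      sOne (Sum.elim R.eb R.ec) = sOne R.eb + (n : ℝ) - R.delta := by
  have h0 : R.CNT0 = _ := hR.isLeast_polyP.csInf_eq
  have h1 : R.CNT1 = _ := hR.isLeast_polyPc.csInf_eq
  have h2 : R.CNT2 = _ := hR.isLeast_polyPb.csInf_eq
  have hE : lOneDist (Sum.elim R.eb R.ec) R.polyE = _ := hR.isLeast_polyE.csInf_eq
  exact ⟨hR.isLeast_polyE, hR.isLeast_alongCoord, by rw [h0, hE], h0,
    hR.isLeast_polyPc.nonempty.of_image, hR.isLeast_polyPb.nonempty.of_image,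
    h0.trans h1.symm, h1.trans h2.symm, hR.sOne_eq⟩
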